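/- Let $G=(V,E)$ be a finite simple graph. Then $$\mathrm{ft}(G)\le Z(G)\le(\mathrm{pw}(G)+1)\,\mathrm{ft}(G),$$ where the parameters are defined as follows. Given a set of blue vertices (all others being white), a blue vertex $u$ forces a white vertex $v$ if $v$ is the only white neighbour of $u$; then $v$ turns blue. A set $S\subseteq V$ is a zero forcing set if, starting with exactly the vertices of $S$ blue and applying this rule repeatedly until no vertex can change colour, all vertices become blue. The zero forcing number $Z(G)$ is the minimum size of a zero forcing set. A fort is a non-empty set $F\subseteq V$ such that no vertex of $V\setminus F$ has exactly one neighbour in $F$. The fort number $\mathrm{ft}(G)$ is the maximum number of pairwise disjoint forts in $G$. A path decomposition of $G$ is a sequence $X_1,\dots,X_k$ ($k\ge 1$) of subsets of $V$ such that every vertex lies in some $X_i$, both ends of every edge lie in a common $X_i$, and $v\in X_i\cap X_j$ with $i\le s\le j$ implies $v\in X_s$. Its width is $\max_i|X_i|-1$, and the pathwidth $\mathrm{pw}(G)$ is the least width of a path decomposition of $G$. -/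

import Mathlib

namespace ZeroForcing

variable {V : Type*}

/-- With `B` the set of blue vertices, the vertex `u` forces the vertex `v`: `u` is blue, `v` is
white, and `v` is the only white neighbour of `u`. -/
def Forces (G : SimpleGraph V) (B : Set V) (u v : V) : Prop :=
  u ∈ B ∧ v ∉ B ∧ G.Adj u v ∧ ∀ w, G.Adj u w → w ∉ B → w = v

/-- One application of the colour change rule: some blue vertex forces a white vertex `v`,
and `v` turns blue. -/
def ColourChange (G : SimpleGraph V) (B B' : Set V) : Prop :=
  ∃ u v, Forces G B u v ∧ B' = insert v B

/-- `D` is the set of blue vertices of a derived colouring of `S`: it is reached from `S` by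
iterating the colour change rule, and no vertex can change colour any more. -/
def IsDerivedColouring (G : SimpleGraph V) (S D : Set V) : Prop :=
  Relation.ReflTransGen (ColourChange G) S D ∧ ∀ u v, ¬ Forces G D u v

/-- `S` is a zero forcing set: all vertices are blue in its derived colouring. -/
def IsZeroForcingSet (G : SimpleGraph V) (S : Set V) : Prop :=
  IsDerivedColouring G S Set.univ

/-- The zero forcing number `Z(G)`: the minimum size of a zero forcing set (for finite `V` the set
of sizes is nonempty, since the whole vertex set is zero forcing). -/
noncomputable def zeroForcingNumber (G : SimpleGraph V) : ℕ :=
  sInf {n | ∃ S : Finset V, IsZeroForcingSet G (S : Set V) ∧ S.card = n}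

/-- A fort: a nonempty set `F` of vertices such that no vertex outside `F` has exactly one
neighbour in `F`. -/
def IsFort (G : SimpleGraph V) (F : Finset V) : Prop :=
  F.Nonempty ∧ ∀ v, v ∉ F → ¬ ∃! u, u ∈ F ∧ G.Adj v u

/-- A fort packing: a collection of mutually disjoint forts. -/
def IsFortPacking (G : SimpleGraph V) (P : Finset (Finset V)) : Prop :=
  (∀ F ∈ P, IsFort G F) ∧ ∀ F ∈ P, ∀ F' ∈ P, F ≠ F' → Disjoint F F'

/-- The fort number `ft(G)`: the maximum size of a fort packing (for finite `V` the set of sizes is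
nonempty and bounded). -/
noncomputable def fortNumber (G : SimpleGraph V) : ℕ :=
  sSup {n | ∃ P : Finset (Finset V), IsFortPacking G P ∧ P.card = n}

/-- A path decomposition of `G`: a sequence of bags `X_0, …, X_last` such that every vertex and
every edge is contained in some bag, and the bags containing a given vertex are consecutive. -/
structure PathDecomposition (G : SimpleGraph V) where
  last : ℕ
  bag : Fin (last + 1) → Finset V
  vertex_mem : ∀ v, ∃ i, v ∈ bag i
  edge_mem : ∀ u v, G.Adj u v → ∃ i, u ∈ bag i ∧ v ∈ bag i
  interval : ∀ v i j s, i ≤ s → s ≤ j → v ∈ bag i → v ∈ bag j → v ∈ bag s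

/-- The width: one less than the maximum size of a bag (an integer, `-1` if all bags are empty). -/
def PathDecomposition.width {G : SimpleGraph V} (X : PathDecomposition G) : ℤ :=
  ((Finset.univ.sup fun i => (X.bag i).card : ℕ) : ℤ) - 1

/-- The pathwidth `pw(G)`: the least width of a path decomposition (for finite `V` the set of
widths is nonempty, and it is bounded below by `-1`). -/
noncomputable def pathwidth (G : SimpleGraph V) : ℤ :=
  sInf {w | ∃ X : PathDecomposition G, X.width = w}

end ZeroForcing

namespace ZeroForcing

variable {V : Type*} {G : SimpleGraph V}

/-! Lower bound: the complement of a fort is stalled, so a zero forcing set meets every fort, and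
disjoint forts need distinct vertices. Upper bound (`exists_isFortPacking`): sweep along a path
decomposition, keeping a fort packing `P` in the bags seen and a set `S` with at most `width + 1`
vertices per fort that forces everything once the unseen vertices are blue. If this breaks at the
next bag, the stalled colouring responsible has a new fort as its complement. Adding the bag to `S`
repairs forcing, and reversing the forcing chains (`exists_reversal`) makes the set force all seen
vertices without help from the unseen ones, which keeps later forts disjoint. -/

/-- A set of blue vertices is stalled if no vertex can change colour. -/
def IsStalled (G : SimpleGraph V) (D : Set V) : Prop :=
  ∀ u v, ¬ Forces G D u v

theorem Forces.of_subset {B D : Set V} {u v : V} (h : Forces G B u v) (hBD : B ⊆ D)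
    (hv : v ∉ D) : Forces G D u v :=
  ⟨hBD h.1, hv, h.2.2.1, fun w huw hw => h.2.2.2 w huw fun hwB => hw (hBD hwB)⟩

theorem IsStalled.subset_of_reflTransGen {S B D : Set V} (hD : IsStalled G D) (hSD : S ⊆ D)
    (h : Relation.ReflTransGen (ColourChange G) S B) : B ⊆ D := by
  induction h with
  | refl => exact hSD
  | tail _ hstep ih =>
    obtain ⟨u, v, hf, rfl⟩ := hstep
    refine Set.insert_subset ?_ ih
    by_contra hv
    exact hD u v (hf.of_subset ih hv)

theorem exists_isDerivedColouring [Finite V] (G : SimpleGraph V) (S : Set V) :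
    ∃ D, IsDerivedColouring G S D := by
  obtain ⟨D, hD, hmax⟩ := Set.Finite.exists_maximal
    (Set.toFinite {D : Set V | Relation.ReflTransGen (ColourChange G) S D}) ⟨S, .refl⟩
  refine ⟨D, hD, fun u v hf => hf.2.1 ?_⟩
  exact hmax (y := insert v D) (Relation.ReflTransGen.tail hD ⟨u, v, hf, rfl⟩)
    (Set.subset_insert v D) (Set.mem_insert v D)

/-- The derived colouring is the least stalled superset of `S`, so the order of forces is
irrelevant. -/
theorem isZeroForcingSet_iff [Finite V] {S : Set V} :
    IsZeroForcingSet G S ↔ ∀ D, IsStalled G D → S ⊆ D → D = Set.univ := by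
  constructor
  · intro h D hD hSD
    exact Set.univ_subset_iff.1 (hD.subset_of_reflTransGen hSD h.1)
  · intro h
    obtain ⟨D, hSD, hD⟩ := exists_isDerivedColouring G S
    have hsub : S ⊆ D := by
      clear hD
      induction hSD with
      | refl => exact subset_rfl
      | tail _ hstep ih =>
        obtain ⟨u, v, -, rfl⟩ := hstep
        exact ih.trans (Set.subset_insert _ _)
    obtain rfl := h D hD hsub
    exact ⟨hSD, hD⟩

theorem IsZeroForcingSet.mono [Finite V] {S T : Set V} (hS : IsZeroForcingSet G S)
    (hST : S ⊆ T) : IsZeroForcingSet G T :=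
  isZeroForcingSet_iff.2 fun D hD hTD => isZeroForcingSet_iff.1 hS D hD (hST.trans hTD)

theorem isZeroForcingSet_univ (G : SimpleGraph V) : IsZeroForcingSet G Set.univ :=
  ⟨.refl, fun _ v h => h.2.1 (Set.mem_univ v)⟩

/-! ### Forts as complements of stalled sets, and the lower bound -/

theorem IsFort.isStalled_compl {F : Finset V} (hF : IsFort G F) :
    IsStalled G ((F : Set V)ᶜ) := by
  rintro u v ⟨hu, hv, huv, huniq⟩
  refine hF.2 u (by simpa using hu) ⟨v, ⟨by simpa using hv, huv⟩, ?_⟩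
  rintro w ⟨hw, huw⟩
  exact huniq w huw (by simpa using hw)

theorem IsStalled.isFort {F : Finset V} (h : IsStalled G ((F : Set V)ᶜ)) (hF : F.Nonempty) :
    IsFort G F := by
  refine ⟨hF, ?_⟩
  rintro v hv ⟨u, ⟨hu, hvu⟩, huniq⟩
  exact h v u ⟨by simpa using hv, by simpa using hu, hvu,
    fun w hvw hw => huniq w ⟨by simpa using hw, hvw⟩⟩

theorem IsFort.exists_mem_of_isZeroForcingSet [Finite V] {F : Finset V} (hF : IsFort G F)
    {S : Set V} (hS : IsZeroForcingSet G S) : ∃ v ∈ F, v ∈ S := by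
  by_contra! hdisj
  have huniv := isZeroForcingSet_iff.1 hS _ hF.isStalled_compl
    fun v hv hvF => hdisj v (by simpa using hvF) hv
  obtain ⟨v, hv⟩ := hF.1
  have : v ∈ ((F : Set V)ᶜ) := huniv ▸ Set.mem_univ v
  exact this (by simpa using hv)

theorem IsFortPacking.card_le [Finite V] {P : Finset (Finset V)} (hP : IsFortPacking G P)
    {S : Finset V} (hS : IsZeroForcingSet G (S : Set V)) : P.card ≤ S.card := by
  refine Finset.card_le_card_of_forall_subsingleton (fun F v => v ∈ F) ?_ ?_
  · intro F hF
    obtain ⟨v, hvF, hvS⟩ := (hP.1 F hF).exists_mem_of_isZeroForcingSet hS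
    exact ⟨v, by simpa using hvS, hvF⟩
  · rintro v - F ⟨hF, hvF⟩ F' ⟨hF', hvF'⟩
    by_contra hne
    exact Finset.disjoint_left.1 (hP.2 F hF F' hF' hne) hvF hvF'

theorem exists_isZeroForcingSet_card_eq [Finite V] (G : SimpleGraph V) :
    ∃ S : Finset V, IsZeroForcingSet G (S : Set V) ∧ S.card = zeroForcingNumber G := by
  have := Fintype.ofFinite V
  exact Nat.sInf_mem (s := {n | ∃ S : Finset V, IsZeroForcingSet G (S : Set V) ∧ S.card = n})
    ⟨_, Finset.univ, by simpa using isZeroForcingSet_univ G, rfl⟩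

theorem fortNumber_le_zeroForcingNumber [Finite V] (G : SimpleGraph V) :
    fortNumber G ≤ zeroForcingNumber G := by
  obtain ⟨S, hS, hcard⟩ := exists_isZeroForcingSet_card_eq G
  refine csSup_le ⟨0, ∅, by simp [IsFortPacking], rfl⟩ ?_
  rintro n ⟨P, hP, rfl⟩
  exact hcard ▸ hP.card_le hS

theorem IsFortPacking.card_le_fortNumber [Finite V] {P : Finset (Finset V)}
    (hP : IsFortPacking G P) : P.card ≤ fortNumber G := by
  obtain ⟨S, hS, -⟩ := exists_isZeroForcingSet_card_eq G
  refine le_csSup ⟨S.card, ?_⟩ ⟨P, hP, rfl⟩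
  rintro n ⟨Q, hQ, rfl⟩
  exact hQ.card_le hS

/-- Reversal of forcing chains: if `Y ∪ R` is zero forcing and `R` has no neighbours outside
`Y ∪ R`, then the ends of the forcing chains starting in `Y` force every vertex outside `R`. -/
theorem exists_reversal {Y : Finset V} {R : Set V}
    (hzf : IsZeroForcingSet G ((Y : Set V) ∪ R))
    (hR : ∀ r ∈ R, ∀ w, G.Adj r w → w ∈ (Y : Set V) ∪ R) :
    ∃ T : Finset V, T.card ≤ Y.card ∧ ∀ D, IsStalled G D → (T : Set V) ⊆ D → Rᶜ ⊆ D := by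
  classical
  -- Here `T` holds the current chain ends; blue vertices outside `T` and `R` have no white
  -- neighbours left.
  suffices h : ∀ B, Relation.ReflTransGen (ColourChange G) ((Y : Set V) ∪ R) B →
      (Y : Set V) ∪ R ⊆ B ∧ ∃ T : Finset V, T.card ≤ Y.card ∧
        (∀ v ∈ B, v ∉ T → v ∉ R → ∀ w, G.Adj v w → w ∈ B) ∧
        ∀ D, IsStalled G D → (T : Set V) ∪ Bᶜ ⊆ D → Rᶜ ⊆ D by
    obtain ⟨-, T, hcard, -, hT⟩ := h _ hzf.1
    exact ⟨T, hcard, fun D hD hTD => hT D hD (by simpa using hTD)⟩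
  intro B hB
  induction hB with
  | refl =>
    refine ⟨subset_rfl, Y, le_rfl, ?_, ?_⟩
    · rintro v (hv | hv) hvY hvR
      · exact absurd hv hvY
      · exact absurd hv hvR
    · intro D _ hD v hv
      by_cases hvY : v ∈ Y
      · exact hD (Or.inl hvY)
      · exact hD (Or.inr fun h => h.elim hvY hv)
  | @tail B B' _ hstep ih =>
    obtain ⟨hYB, T, hcard, hused, hT⟩ := ih
    obtain ⟨u, w, ⟨huB, hwB, huw, huniq⟩, rfl⟩ := hstep
    have hnotR : ∀ x ∈ R, ¬ G.Adj x w := fun x hx hxw => hwB (hYB (hR x hx w hxw))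
    have hunused : ∀ x ∈ B, G.Adj x w → x ∈ T := fun x hx hxw => by
      by_contra hxT
      exact hwB (hused x hx hxT (fun hxR => hnotR x hxR hxw) w hxw)
    -- The chain through `u` now ends at `w`. In reverse `w` forces `u`, since by `hunused` the
    -- other neighbours of `w` lie in `T` or outside `B`.
    refine ⟨hYB.trans (Set.subset_insert _ _), insert w (T.erase u), ?_, ?_, ?_⟩
    · have h1 := Finset.card_insert_le w (T.erase u)
      have h2 := Finset.card_erase_add_one (hunused u huB huw)
      omega
    · intro v hv hvT hvR x hvx
      rw [Finset.mem_insert, Finset.mem_erase, not_or] at hvT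
      have hvB : v ∈ B := hv.resolve_left hvT.1
      by_cases hvu : v = u
      · subst hvu
        by_cases hx : x ∈ B
        · exact Or.inr hx
        · exact Or.inl (huniq x hvx hx)
      · exact Or.inr (hused v hvB (fun h => hvT.2 ⟨hvu, h⟩) hvR x hvx)
    · intro D hD hsub
      have hwD : w ∈ D := hsub (Or.inl (by simp))
      have hmem : ∀ x, x ≠ u → x ∈ (T : Set V) ∪ Bᶜ → x ∈ D := by
        intro x hxu hx
        by_cases hxw : x = w
        · exact hxw ▸ hwD
        rcases hx with hx | hx
        · exact hsub (Or.inl (by simp [hxu, Finset.mem_coe.1 hx]))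
        · exact hsub (Or.inr fun h => h.elim hxw hx)
      have huD : u ∈ D := by
        by_contra huD
        refine hD w u ⟨hwD, huD, huw.symm, fun x hwx hxD => ?_⟩
        by_contra hxu
        refine hxD (hmem x hxu ?_)
        by_cases hxB : x ∈ B
        · exact Or.inl (hunused x hxB hwx.symm)
        · exact Or.inr hxB
      refine hT D hD fun x hx => ?_
      by_cases hxu : x = u
      · exact hxu ▸ huD
      · exact hmem x hxu hx

/-! ### Sweeping along a path decomposition -/

namespace PathDecomposition

/-- The union of the first `n` bags. -/
def initial (X : PathDecomposition G) (n : ℕ) : Set V :=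
  {v | ∃ i : Fin (X.last + 1), i.val < n ∧ v ∈ X.bag i}

theorem initial_mono (X : PathDecomposition G) {m n : ℕ} (h : m ≤ n) :
    X.initial m ⊆ X.initial n :=
  fun _ ⟨i, hi, hv⟩ => ⟨i, hi.trans_le h, hv⟩

theorem initial_succ_subset (X : PathDecomposition G) (i : Fin (X.last + 1)) :
    X.initial (i.val + 1) ⊆ X.initial i.val ∪ X.bag i := by
  rintro v ⟨j, hj, hv⟩
  rcases Nat.lt_succ_iff_lt_or_eq.1 hj with h | h
  · exact Or.inl ⟨j, h, hv⟩
  · exact Or.inr (Fin.ext h ▸ hv)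

/-- Each bag separates the vertices of the earlier bags from those of the later ones. -/
theorem mem_bag_of_adj (X : PathDecomposition G) (i : Fin (X.last + 1)) {r w : V}
    (hr : r ∉ X.initial (i.val + 1)) (hw : w ∈ X.initial (i.val + 1)) (h : G.Adj r w) :
    w ∈ X.bag i := by
  obtain ⟨k, hrk, hwk⟩ := X.edge_mem r w h
  obtain ⟨j, hj, hwj⟩ := hw
  refine X.interval w j k i (Fin.le_def.2 (by omega)) (Fin.le_def.2 ?_) hwj hwk
  by_contra hk
  exact hr ⟨k, by omega, hrk⟩

theorem card_bag_le_width (X : PathDecomposition G) (i : Fin (X.last + 1)) :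
    ((X.bag i).card : ℤ) ≤ X.width + 1 := by
  have h : (X.bag i).card ≤ Finset.univ.sup fun i => (X.bag i).card :=
    Finset.le_sup (f := fun i => (X.bag i).card) (Finset.mem_univ i)
  simp only [width]
  omega

theorem exists_isFortPacking [Finite V] (X : PathDecomposition G) (n : ℕ)
    (hn : n ≤ X.last + 1) :
    ∃ (P : Finset (Finset V)) (S : Finset V),
      IsFortPacking G P ∧ (S.card : ℤ) ≤ (X.width + 1) * P.card ∧
      (∀ F ∈ P, (F : Set V) ⊆ X.initial n) ∧
      (∀ F ∈ P, ∀ D, IsStalled G D → (S : Set V) ⊆ D → (F : Set V) ⊆ D) ∧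
      IsZeroForcingSet G ((S : Set V) ∪ (X.initial n)ᶜ) := by
  classical
  have := Fintype.ofFinite V
  induction n with
  | zero =>
    refine ⟨∅, ∅, by simp [IsFortPacking], by simp, by simp, by simp, ?_⟩
    simpa [initial] using isZeroForcingSet_univ G
  | succ n ih =>
    obtain ⟨P, S, hP, hcard, hPX, hSP, hzf⟩ := ih (by omega)
    by_cases hnext : IsZeroForcingSet G ((S : Set V) ∪ (X.initial (n + 1))ᶜ)
    · exact ⟨P, S, hP, hcard,
        fun F hF => (hPX F hF).trans (X.initial_mono n.le_succ), hSP, hnext⟩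
    rw [isZeroForcingSet_iff] at hnext
    push Not at hnext
    obtain ⟨D, hD, hsub, hne⟩ := hnext
    -- `D` contains `S`, hence every fort of `P`, and also every unseen vertex; so its complement is
    -- a new fort, disjoint from the old ones.
    obtain ⟨F, hFD⟩ : ∃ F : Finset V, (F : Set V)ᶜ = D := ⟨Dᶜ.toFinset, by simp⟩
    have hFne : F.Nonempty := by
      rw [Finset.nonempty_iff_ne_empty]
      rintro rfl
      exact hne (by simpa using hFD.symm)
    have hF : IsFort G F := IsStalled.isFort (hFD ▸ hD) hFne
    have hFX : (F : Set V) ⊆ X.initial (n + 1) := fun v hv => by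
      by_contra hvX
      have hvD := hsub (Or.inr hvX)
      rw [← hFD] at hvD
      exact hvD hv
    have hdisj : ∀ F' ∈ P, Disjoint F F' := fun F' hF' =>
      Finset.disjoint_left.2 fun v hv hv' => by
        have hvD := hSP F' hF' D hD (Set.subset_union_left.trans hsub) hv'
        rw [← hFD] at hvD
        exact hvD hv
    have hFP : F ∉ P := fun h => hFne.ne_empty (disjoint_self.1 (hdisj F h))
    let i : Fin (X.last + 1) := ⟨n, by omega⟩
    have hzf' : IsZeroForcingSet G (((S ∪ X.bag i : Finset V) : Set V) ∪
        (X.initial (n + 1))ᶜ) := by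
      refine hzf.mono ?_
      rintro v (hv | hv)
      · exact Or.inl (by simp [Finset.mem_coe.1 hv])
      · by_cases hv' : v ∈ X.initial (n + 1)
        · rcases X.initial_succ_subset i hv' with h | h
          · exact absurd h hv
          · exact Or.inl (by simp [Finset.mem_coe.1 h])
        · exact Or.inr hv'
    -- The bag separates seen from unseen vertices, so the latter can serve as `R`.
    obtain ⟨T, hTcard, hT⟩ := exists_reversal hzf' fun r hr w hrw => by
      by_cases hw : w ∈ X.initial (n + 1)
      · exact Or.inl (by simp [X.mem_bag_of_adj i hr hw hrw])
      · exact Or.inr hw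
    rw [compl_compl] at hT
    have hsubX : ∀ F' ∈ insert F P, (F' : Set V) ⊆ X.initial (n + 1) := fun F' hF' => by
      rcases Finset.mem_insert.1 hF' with rfl | h
      · exact hFX
      · exact (hPX F' h).trans (X.initial_mono n.le_succ)
    refine ⟨insert F P, T, ⟨?_, ?_⟩, ?_, hsubX,
      fun F' hF' D hD hTD => (hsubX F' hF').trans (hT D hD hTD), ?_⟩
    · intro F' hF'
      rcases Finset.mem_insert.1 hF' with rfl | h
      · exact hF
      · exact hP.1 F' h
    · intro F₁ h₁ F₂ h₂ h12
      rcases Finset.mem_insert.1 h₁ with rfl | h₁' <;>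
        rcases Finset.mem_insert.1 h₂ with rfl | h₂'
      · exact absurd rfl h12
      · exact hdisj _ h₂'
      · exact (hdisj _ h₁').symm
      · exact hP.2 _ h₁' _ h₂' h12
    · rw [Finset.card_insert_of_notMem hFP]
      have h1 := Finset.card_union_le S (X.bag i)
      have h2 := X.card_bag_le_width i
      push_cast
      have h3 : (T.card : ℤ) ≤ S.card + (X.bag i).card := by exact_mod_cast hTcard.trans h1
      linarith
    · rw [isZeroForcingSet_iff]
      intro D hD hsub
      rw [Set.eq_univ_iff_forall]
      intro v
      by_cases hv : v ∈ X.initial (n + 1)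
      · exact hT D hD (Set.subset_union_left.trans hsub) hv
      · exact hsub (Or.inr hv)

end PathDecomposition

theorem exists_pathDecomposition_width_eq [Finite V] (G : SimpleGraph V) :
    ∃ X : PathDecomposition G, X.width = pathwidth G := by
  have := Fintype.ofFinite V
  refine Int.csInf_mem (s := {w | ∃ X : PathDecomposition G, X.width = w}) ?_ ⟨-1, ?_⟩
  · exact ⟨_, ⟨0, fun _ => Finset.univ, fun v => ⟨0, Finset.mem_univ v⟩,
      fun u v _ => ⟨0, Finset.mem_univ u, Finset.mem_univ v⟩,
      fun v _ _ _ _ _ _ _ => Finset.mem_univ v⟩, rfl⟩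
  · rintro w ⟨X, rfl⟩
    simp only [PathDecomposition.width]
    omega

theorem zeroForcingNumber_le [Finite V] (G : SimpleGraph V) :
    (zeroForcingNumber G : ℤ) ≤ (pathwidth G + 1) * (fortNumber G : ℤ) := by
  obtain ⟨X, hX⟩ := exists_pathDecomposition_width_eq G
  obtain ⟨P, S, hP, hcard, -, -, hzf⟩ := X.exists_isFortPacking (X.last + 1) le_rfl
  have huniv : X.initial (X.last + 1) = Set.univ := Set.eq_univ_of_forall fun v =>
    let ⟨i, hi⟩ := X.vertex_mem v
    ⟨i, i.isLt, hi⟩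
  rw [huniv, Set.compl_univ, Set.union_empty] at hzf
  have hZ : zeroForcingNumber G ≤ S.card := Nat.sInf_le ⟨S, hzf, rfl⟩
  -- The width is an integer that may be `-1`, so the sign needs checking.
  have hw : 0 ≤ X.width + 1 := (Int.natCast_nonneg _).trans (X.card_bag_le_width 0)
  calc (zeroForcingNumber G : ℤ) ≤ S.card := by exact_mod_cast hZ
    _ ≤ (X.width + 1) * P.card := hcard
    _ ≤ (X.width + 1) * fortNumber G :=
      mul_le_mul_of_nonneg_left (by exact_mod_cast hP.card_le_fortNumber) hw
    _ = _ := by rw [hX]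

end ZeroForcing

theorem mainTheorem1 {V : Type*} [Finite V] (G : SimpleGraph V) :
    ZeroForcing.fortNumber G ≤ ZeroForcing.zeroForcingNumber G ∧
      (ZeroForcing.zeroForcingNumber G : ℤ) ≤
        (ZeroForcing.pathwidth G + 1) * (ZeroForcing.fortNumber G : ℤ) :=
  ⟨ZeroForcing.fortNumber_le_zeroForcingNumber G, ZeroForcing.zeroForcingNumber_le G⟩
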